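/- **Theorem (Allegretto–Piepenbrink).** Let $V$ be a countable set, $m:V\to(0,\infty)$, $c:V\to[0,\infty)$, and let $b:V\times V\to[0,\infty)$ satisfy $b(x,y)=b(y,x)$ for all $x,y\in V$ and $\sum_{y\in V}b(x,y)<\infty$ for all $x\in V$. Write $x\sim y$ if $b(x,y)>0$. Let $\ell^2(V,m)$ be the real Hilbert space of functions $u:V\to\mathbb R$ with $\sum_x u(x)^2m(x)<\infty$ and scalar product $\langle u,v\rangle=\sum_x u(x)v(x)m(x)$. For $u\in\ell^2(V,m)$ put $$Q^{\max}(u)=\frac12\sum_{x,y\in V}b(x,y)(u(x)-u(y))^2+\sum_{x\in V}c(x)u(x)^2\in[0,\infty],$$ and let $D(Q)$ be the closure of the finitely supported functions in $\ell^2(V,m)$ with respect to the form norm $(\|u\|^2+Q^{\max}(u))^{1/2}$. For $u,v\in D(Q)$ let $$Q(u,v)=\frac12\sum_{x,y\in V}b(x,y)(u(x)-u(y))(v(x)-v(y))+\sum_{x\in V}c(x)u(x)v(x),$$ and let $L$ be the self-adjoint operator on $\ell^2(V,m)$ associated with $Q$: $u\in D(L)$ and $Lu=f$ if and only if $u\in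 D(Q)$, $f\in\ell^2(V,m)$ and $Q(u,v)=\langle f,v\rangle$ for all $v\in D(Q)$. Let $\sigma(L)\subseteq\mathbb R$ be its spectrum and $E_0=\inf\sigma(L)$. Let $\widetilde F$ be the set of $w:V\to\mathbb R$ with $\sum_{y}b(x,y)|w(y)|<\infty$ for all $x\in V$, and for $w\in\widetilde F$ let $$\widetilde L w(x)=\frac1{m(x)}\sum_{y\in V}b(x,y)(w(x)-w(y))+\frac{c(x)}{m(x)}w(x),\qquad x\in V.$$ Suppose that $V$ is infinite and connected (any two vertices $x,y$ are joined by a finite path $x=x_0\sim x_1\sim\dots\sim x_n=y$), and let $E\in\mathbb R$. Then $\sigma(L)$ is non-empty and bounded below, so that $E_0\in\mathbb R$, and the following are equivalent: 1. $E\le E_0$. 2. There is $w\in\widetilde F$, $w\not\equiv0$, with $w(x)\ge0$ and $(\widetilde L-E)w(x)\ge0$ for all $x\in V$. 3. There is $w\in\widetilde F$ with $w(x)>0$ and $(\widetilde L-E)w(x)\ge0$ for all $x\in V$. If moreover the graph is locally finite, i.e. $\{y\in V: x\sim y\}$ is finite for every $x\in V$, then these are also equivalent to: 4. There is $w\in\widetilde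 F$ with $w(x)>0$ and $(\widetilde L-E)w(x)=0$ for all $x\in V$. -/

import Mathlib

open scoped ENNReal

noncomputable section

/-- A graph `b` over a discrete measure space `(V, m)` together with a killing term `c`. -/
structure WeightedGraph (V : Type*) where
  m : V → ℝ
  m_pos : ∀ x, 0 < m x
  b : V → V → ℝ
  b_nonneg : ∀ x y, 0 ≤ b x y
  b_symm : ∀ x y, b x y = b y x
  b_summable : ∀ x, Summable fun y => b x y
  c : V → ℝ
  c_nonneg : ∀ x, 0 ≤ c x

namespace WeightedGraph

variable {V : Type*} (G : WeightedGraph V)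

/-- `x ∼ y`: the vertices `x` and `y` form an edge. -/
def Adj (x y : V) : Prop := 0 < G.b x y

/-- Every vertex has only finitely many neighbours. -/
def LocallyFinite : Prop := ∀ x, {y | G.Adj x y}.Finite

/-- Any two vertices are joined by a finite path `x = x₀ ∼ x₁ ∼ ⋯ ∼ xₙ = y`. -/
def Connected : Prop := ∀ x y, Relation.ReflTransGen G.Adj x y

/-! ### The Hilbert space `ℓ²(V, m)` -/

/-- The square summable functions with respect to the weight `m`, as a subspace of all functions. -/
def l2Submodule : Submodule ℝ (V → ℝ) where
  carrier := {u | Summable fun x => u x ^ 2 * G.m x}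
  zero_mem' := by simp
  add_mem' := by
    intro u v hu hv
    refine Summable.of_nonneg_of_le (fun x => mul_nonneg (sq_nonneg _) (G.m_pos x).le) (fun x => ?_)
      ((hu.mul_left 2).add (hv.mul_left 2))
    have := G.m_pos x
    simp only [Pi.add_apply]
    nlinarith [mul_nonneg (sq_nonneg (u x - v x)) this.le]
  smul_mem' := by
    intro a u hu
    refine (hu.mul_left (a ^ 2)).congr fun x => ?_
    simp only [Pi.smul_apply, smul_eq_mul]
    ring

/-- The Hilbert space `ℓ²(V, m)`; its elements are actual functions on `V`, and its norm and
scalar product are defined below (they are not the ones of the product space `V → ℝ`). -/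
def L2 : Type _ := G.l2Submodule

instance : AddCommGroup G.L2 := inferInstanceAs (AddCommGroup G.l2Submodule)

instance : Module ℝ G.L2 := inferInstanceAs (Module ℝ G.l2Submodule)

instance : CoeFun G.L2 (fun _ => V → ℝ) := ⟨fun u => u.1⟩

variable {G}

@[ext] theorem L2.ext {u v : G.L2} (h : ∀ x, u x = v x) : u = v := Subtype.ext (funext h)

theorem L2.summable_sq (u : G.L2) : Summable fun x => u x ^ 2 * G.m x := u.2

theorem L2.coe_add (u v : G.L2) : ((u + v : G.L2) : V → ℝ) = fun x => u x + v x := rfl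

theorem L2.coe_sub (u v : G.L2) : ((u - v : G.L2) : V → ℝ) = fun x => u x - v x := rfl

theorem L2.coe_smul (a : ℝ) (u : G.L2) : ((a • u : G.L2) : V → ℝ) = fun x => a * u x := rfl

theorem L2.coe_zero : ((0 : G.L2) : V → ℝ) = fun _ => 0 := rfl

theorem L2.summable_mul (u v : G.L2) : Summable fun x => u x * v x * G.m x := by
  refine Summable.of_norm_bounded (u.summable_sq.add v.summable_sq) fun x => ?_
  have hm := G.m_pos x
  rw [Real.norm_eq_abs, abs_mul, abs_mul, abs_of_pos hm, ← sq_abs (u x), ← sq_abs (v x)]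
  nlinarith [mul_nonneg (sq_nonneg (|u x| - |v x|)) hm.le, mul_nonneg (abs_nonneg (u x))
    (mul_nonneg (abs_nonneg (v x)) hm.le)]

variable (G)

/-- The scalar product `⟨u, v⟩ = ∑ u(x) v(x) m(x)`. -/
@[reducible] def innerCore : InnerProductSpace.Core ℝ G.L2 where
  inner u v := ∑' x, u x * v x * G.m x
  conj_inner_symm u v := by
    simp only [conj_trivial]
    exact tsum_congr fun x => by ring
  re_inner_nonneg u := by
    simp only [RCLike.re_to_real]
    exact tsum_nonneg fun x => mul_nonneg (mul_self_nonneg _) (G.m_pos x).le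
  add_left u v w := by
    rw [← (u.summable_mul w).tsum_add (v.summable_mul w)]
    exact tsum_congr fun x => by rw [L2.coe_add]; ring
  smul_left u v a := by
    simp only [conj_trivial]
    rw [← tsum_mul_left]
    exact tsum_congr fun x => by rw [L2.coe_smul]; ring
  definite u h := by
    have h0 : ∀ x, 0 ≤ u x * u x * G.m x := fun x =>
      mul_nonneg (mul_self_nonneg _) (G.m_pos x).le
    have h1 : HasSum (fun x => u x * u x * G.m x) 0 := by
      rw [← h]; exact (u.summable_mul u).hasSum
    have h2 := (hasSum_zero_iff_of_nonneg h0).1 h1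
    ext x
    have h3 := congrFun h2 x
    have hm := (G.m_pos x).ne'
    simpa [hm, L2.coe_zero] using h3

instance : NormedAddCommGroup G.L2 := G.innerCore.toNormedAddCommGroup

instance : InnerProductSpace ℝ G.L2 := InnerProductSpace.ofCore G.innerCore.toCore

theorem inner_def (u v : G.L2) : inner ℝ u v = ∑' x, u x * v x * G.m x := rfl

/-! ### The form -/

/-- The maximal form
`Qᵐᵃˣ(u) = ½ ∑_{x,y} b(x,y) (u(x) - u(y))² + ∑ₓ c(x) u(x)²`, with values in `[0, ∞]`. -/
def Qmax (u : V → ℝ) : ℝ≥0∞ :=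
  2⁻¹ * ∑' p : V × V, ENNReal.ofReal (G.b p.1 p.2 * (u p.1 - u p.2) ^ 2)
    + ∑' x, ENNReal.ofReal (G.c x * u x ^ 2)

/-- The bilinear form
`Q(u,v) = ½ ∑_{x,y} b(x,y) (u(x) - u(y)) (v(x) - v(y)) + ∑ₓ c(x) u(x) v(x)`;
the sums converge absolutely for functions with `Qᵐᵃˣ < ∞`. -/
def Q (u v : V → ℝ) : ℝ :=
  2⁻¹ * ∑' p : V × V, G.b p.1 p.2 * (u p.1 - u p.2) * (v p.1 - v p.2)
    + ∑' x, G.c x * u x * v x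

theorem Qmax_add_le (u v : V → ℝ) :
    G.Qmax (fun x => u x + v x) ≤ 2 * G.Qmax u + 2 * G.Qmax v := by
  have key : ∀ a s t : ℝ, 0 ≤ a → ENNReal.ofReal (a * (s + t) ^ 2) ≤
      2 * ENNReal.ofReal (a * s ^ 2) + 2 * ENNReal.ofReal (a * t ^ 2) := by
    intro a s t ha
    have h2 : (2 : ℝ≥0∞) = ENNReal.ofReal 2 := by simp
    rw [h2, ← ENNReal.ofReal_mul (by norm_num), ← ENNReal.ofReal_mul (by norm_num),
      ← ENNReal.ofReal_add (by positivity) (by positivity)]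
    apply ENNReal.ofReal_le_ofReal
    nlinarith [mul_nonneg ha (sq_nonneg (s - t))]
  have h1 : ∑' p : V × V, ENNReal.ofReal (G.b p.1 p.2 * ((u p.1 + v p.1) - (u p.2 + v p.2)) ^ 2) ≤
      2 * ∑' p : V × V, ENNReal.ofReal (G.b p.1 p.2 * (u p.1 - u p.2) ^ 2) +
      2 * ∑' p : V × V, ENNReal.ofReal (G.b p.1 p.2 * (v p.1 - v p.2) ^ 2) := by
    rw [← ENNReal.tsum_mul_left, ← ENNReal.tsum_mul_left, ← ENNReal.tsum_add]
    refine ENNReal.tsum_le_tsum fun p => ?_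
    have := key (G.b p.1 p.2) (u p.1 - u p.2) (v p.1 - v p.2) (G.b_nonneg _ _)
    rwa [show u p.1 - u p.2 + (v p.1 - v p.2) = (u p.1 + v p.1) - (u p.2 + v p.2) by ring] at this
  have h2 : ∑' x, ENNReal.ofReal (G.c x * (u x + v x) ^ 2) ≤
      2 * ∑' x, ENNReal.ofReal (G.c x * u x ^ 2) + 2 * ∑' x, ENNReal.ofReal (G.c x * v x ^ 2) := by
    rw [← ENNReal.tsum_mul_left, ← ENNReal.tsum_mul_left, ← ENNReal.tsum_add]
    exact ENNReal.tsum_le_tsum fun x => key _ _ _ (G.c_nonneg x)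
  unfold Qmax
  refine (add_le_add (mul_le_mul_right h1 _) h2).trans (le_of_eq ?_)
  ring

theorem Qmax_smul (a : ℝ) (u : V → ℝ) :
    G.Qmax (fun x => a * u x) = ENNReal.ofReal (a ^ 2) * G.Qmax u := by
  have h1 : ∑' p : V × V, ENNReal.ofReal (G.b p.1 p.2 * (a * u p.1 - a * u p.2) ^ 2) =
      ENNReal.ofReal (a ^ 2) * ∑' p : V × V, ENNReal.ofReal (G.b p.1 p.2 * (u p.1 - u p.2) ^ 2) := by
    rw [← ENNReal.tsum_mul_left]
    refine tsum_congr fun p => ?_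
    rw [← ENNReal.ofReal_mul (sq_nonneg a)]
    congr 1; ring
  have h2 : ∑' x, ENNReal.ofReal (G.c x * (a * u x) ^ 2) =
      ENNReal.ofReal (a ^ 2) * ∑' x, ENNReal.ofReal (G.c x * u x ^ 2) := by
    rw [← ENNReal.tsum_mul_left]
    refine tsum_congr fun x => ?_
    rw [← ENNReal.ofReal_mul (sq_nonneg a)]
    congr 1; ring
  unfold Qmax
  rw [h1, h2]
  ring

/-- Finitely supported functions have finite energy. -/
theorem Qmax_lt_top_of_finite_support {u : V → ℝ} (hu : (Function.support u).Finite) :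
    G.Qmax u < ∞ := by
  have hdeg : ∀ x, ∑' y, ENNReal.ofReal (G.b x y) < ∞ := fun x => by
    rw [← ENNReal.ofReal_tsum_of_nonneg (G.b_nonneg x) (G.b_summable x)]
    exact ENNReal.ofReal_lt_top
  have hfin : ∀ f : V → ℝ≥0∞, (∀ x, u x = 0 → f x = 0) → (∀ x, f x < ∞) → ∑' x, f x < ∞ := by
    intro f h0 hf
    rw [tsum_eq_sum (s := hu.toFinset) (fun x hx => h0 x (by simpa using hx))]
    exact ENNReal.sum_lt_top.2 fun x _ => hf x
  have hA : ∑' x, ∑' y, ENNReal.ofReal (u x ^ 2) * ENNReal.ofReal (G.b x y) < ∞ := by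
    refine hfin _ (fun x hx => by simp [hx]) fun x => ?_
    rw [ENNReal.tsum_mul_left]
    exact ENNReal.mul_lt_top ENNReal.ofReal_lt_top (hdeg x)
  have hB : ∑' x, ∑' y, ENNReal.ofReal (u y ^ 2) * ENNReal.ofReal (G.b x y) < ∞ := by
    rw [ENNReal.tsum_comm]
    refine lt_of_eq_of_lt ?_ hA
    exact tsum_congr fun x => tsum_congr fun y => by rw [G.b_symm]
  have hE : ∑' p : V × V, ENNReal.ofReal (G.b p.1 p.2 * (u p.1 - u p.2) ^ 2) < ∞ := by
    have hle : ∑' p : V × V, ENNReal.ofReal (G.b p.1 p.2 * (u p.1 - u p.2) ^ 2) ≤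
        2 * (∑' x, ∑' y, ENNReal.ofReal (u x ^ 2) * ENNReal.ofReal (G.b x y)) +
        2 * ∑' x, ∑' y, ENNReal.ofReal (u y ^ 2) * ENNReal.ofReal (G.b x y) := by
      rw [← ENNReal.tsum_prod
          (f := fun x y => ENNReal.ofReal (u x ^ 2) * ENNReal.ofReal (G.b x y)),
        ← ENNReal.tsum_prod (f := fun x y => ENNReal.ofReal (u y ^ 2) * ENNReal.ofReal (G.b x y)),
        ← ENNReal.tsum_mul_left, ← ENNReal.tsum_mul_left, ← ENNReal.tsum_add]
      refine ENNReal.tsum_le_tsum fun p => ?_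
      have hb := G.b_nonneg p.1 p.2
      have h2 : (2 : ℝ≥0∞) = ENNReal.ofReal 2 := by simp
      rw [h2, ← ENNReal.ofReal_mul (by positivity), ← ENNReal.ofReal_mul (by positivity),
        ← ENNReal.ofReal_mul (by positivity), ← ENNReal.ofReal_mul (by positivity),
        ← ENNReal.ofReal_add (by positivity) (by positivity)]
      apply ENNReal.ofReal_le_ofReal
      nlinarith [mul_nonneg hb (sq_nonneg (u p.1 + u p.2))]
    refine hle.trans_lt (ENNReal.add_lt_top.2 ⟨?_, ?_⟩)
    · exact ENNReal.mul_lt_top (by simp) hA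
    · exact ENNReal.mul_lt_top (by simp) hB
  refine ENNReal.add_lt_top.2 ⟨ENNReal.mul_lt_top (by simp) hE, ?_⟩
  exact hfin _ (fun x hx => by simp [hx]) fun x => ENNReal.ofReal_lt_top

/-- The square `‖u‖² + Qᵐᵃˣ(u)` of the form norm. -/
def formNormSq (u : G.L2) : ℝ≥0∞ := ‖u‖ₑ ^ 2 + G.Qmax u

theorem enorm_add_sq_le (u v : G.L2) : ‖u + v‖ₑ ^ 2 ≤ 2 * ‖u‖ₑ ^ 2 + 2 * ‖v‖ₑ ^ 2 := by
  have h2 : (2 : ℝ≥0∞) = ENNReal.ofReal 2 := by simp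
  have h : ‖u + v‖ ^ 2 ≤ 2 * ‖u‖ ^ 2 + 2 * ‖v‖ ^ 2 := by
    have := norm_add_le u v
    nlinarith [norm_nonneg (u + v), sq_nonneg (‖u‖ - ‖v‖)]
  simp only [← ofReal_norm]
  rw [h2, ← ENNReal.ofReal_pow (norm_nonneg _), ← ENNReal.ofReal_pow (norm_nonneg _),
    ← ENNReal.ofReal_pow (norm_nonneg _), ← ENNReal.ofReal_mul (by norm_num),
    ← ENNReal.ofReal_mul (by norm_num), ← ENNReal.ofReal_add (by positivity) (by positivity)]
  exact ENNReal.ofReal_le_ofReal h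

theorem formNormSq_add_le (u v : G.L2) :
    G.formNormSq (u + v) ≤ 2 * G.formNormSq u + 2 * G.formNormSq v := by
  refine (add_le_add (G.enorm_add_sq_le u v) (G.Qmax_add_le u v)).trans (le_of_eq ?_)
  unfold formNormSq
  ring

theorem formNormSq_smul (a : ℝ) (u : G.L2) :
    G.formNormSq (a • u) = ENNReal.ofReal (a ^ 2) * G.formNormSq u := by
  have h : ‖a • u‖ₑ ^ 2 = ENNReal.ofReal (a ^ 2) * ‖u‖ₑ ^ 2 := by
    rw [enorm_smul, mul_pow, Real.enorm_eq_ofReal_abs, ← ENNReal.ofReal_pow (abs_nonneg a), sq_abs]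
  unfold formNormSq
  rw [h, L2.coe_smul, Qmax_smul, mul_add]

/-- The form domain `D(Q)`: the closure of the finitely supported functions in `ℓ²(V, m)` with
respect to the form norm. -/
def formDomain : Submodule ℝ G.L2 where
  carrier := {u | ∀ ε : ℝ≥0∞, 0 < ε →
    ∃ φ : G.L2, (Function.support φ).Finite ∧ G.formNormSq (u - φ) < ε}
  zero_mem' := by
    intro ε hε
    refine ⟨0, ?_, ?_⟩
    · simp [L2.coe_zero]
    · simpa [formNormSq, Qmax, L2.coe_zero] using hε
  add_mem' := by
    intro u v hu hv ε hε
    have hε' : 0 < ε / 4 := ENNReal.div_pos hε.ne' (by simp)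
    obtain ⟨φ, hφ, h1⟩ := hu _ hε'
    obtain ⟨ψ, hψ, h2⟩ := hv _ hε'
    refine ⟨φ + ψ, (hφ.union hψ).subset (Function.support_add _ _), ?_⟩
    rw [add_sub_add_comm]
    refine (G.formNormSq_add_le _ _).trans_lt ?_
    have key : 2 * (G.formNormSq (u - φ) + G.formNormSq (v - ψ)) < 2 * (ε / 4 + ε / 4) :=
      ENNReal.mul_lt_mul_right (by simp) (by simp) (ENNReal.add_lt_add h1 h2)
    refine lt_of_lt_of_le (by rwa [← mul_add]) (le_of_eq ?_)
    rw [← two_mul, ← mul_assoc, show (2 : ℝ≥0∞) * 2 = 4 by norm_num]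
    exact ENNReal.mul_div_cancel (by simp) (by simp)
  smul_mem' := by
    intro a u hu ε hε
    rcases eq_or_ne a 0 with rfl | ha
    · refine ⟨0, by simp [L2.coe_zero], ?_⟩
      simpa [formNormSq, Qmax, L2.coe_zero] using hε
    have hpos : ENNReal.ofReal (a ^ 2) ≠ 0 := by
      have : 0 < a ^ 2 := by positivity
      exact (ENNReal.ofReal_pos.2 this).ne'
    obtain ⟨φ, hφ, h⟩ := hu (ε / ENNReal.ofReal (a ^ 2))
      (ENNReal.div_pos hε.ne' ENNReal.ofReal_ne_top)
    refine ⟨a • φ, hφ.subset (Function.support_const_smul_subset a (φ : V → ℝ)), ?_⟩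
    rw [← smul_sub, formNormSq_smul, mul_comm]
    exact (ENNReal.lt_div_iff_mul_lt (Or.inl hpos) (Or.inl ENNReal.ofReal_ne_top)).1 h

theorem mem_formDomain_of_finite_support {u : G.L2} (hu : (Function.support u).Finite) :
    u ∈ G.formDomain := by
  intro ε hε
  refine ⟨u, hu, ?_⟩
  simpa [formNormSq, Qmax, L2.coe_zero] using hε

theorem Qmax_lt_top_of_mem {u : G.L2} (hu : u ∈ G.formDomain) : G.Qmax u < ∞ := by
  obtain ⟨φ, hφ, h⟩ := hu 1 (by simp)
  have h1 : G.Qmax (u - φ : G.L2) < ∞ :=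
    (le_add_self.trans_lt h).trans ENNReal.one_lt_top
  have h2 := G.Qmax_add_le (u - φ : G.L2) φ
  have h3 : (fun x => (u - φ : G.L2) x + φ x) = u := by
    funext x; simp [L2.coe_sub]
  rw [h3] at h2
  exact h2.trans_lt (ENNReal.add_lt_top.2 ⟨ENNReal.mul_lt_top (by simp) h1,
    ENNReal.mul_lt_top (by simp) (G.Qmax_lt_top_of_finite_support hφ)⟩)

variable {G}

theorem summable_edge_sq {u : V → ℝ} (hu : G.Qmax u < ∞) :
    Summable fun p : V × V => G.b p.1 p.2 * (u p.1 - u p.2) ^ 2 := by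
  have h : ∑' p : V × V, ENNReal.ofReal (G.b p.1 p.2 * (u p.1 - u p.2) ^ 2) ≠ ∞ := by
    intro h
    simp [Qmax, h] at hu
  refine (ENNReal.summable_toReal h).congr fun p => ?_
  exact ENNReal.toReal_ofReal (mul_nonneg (G.b_nonneg _ _) (sq_nonneg _))

theorem summable_kill_sq {u : V → ℝ} (hu : G.Qmax u < ∞) :
    Summable fun x => G.c x * u x ^ 2 := by
  have h := (ENNReal.add_lt_top.1 hu).2.ne
  refine (ENNReal.summable_toReal h).congr fun p => ?_
  exact ENNReal.toReal_ofReal (mul_nonneg (G.c_nonneg _) (sq_nonneg _))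

theorem abs_weighted_mul_le {a : ℝ} (ha : 0 ≤ a) (s t : ℝ) :
    ‖a * s * t‖ ≤ a * s ^ 2 + a * t ^ 2 := by
  rw [Real.norm_eq_abs, abs_mul, abs_mul, abs_of_nonneg ha, ← sq_abs s, ← sq_abs t]
  nlinarith [mul_nonneg ha (sq_nonneg (|s| - |t|)),
    mul_nonneg ha (mul_nonneg (abs_nonneg s) (abs_nonneg t))]

theorem summable_edge {u v : V → ℝ} (hu : G.Qmax u < ∞) (hv : G.Qmax v < ∞) :
    Summable fun p : V × V => G.b p.1 p.2 * (u p.1 - u p.2) * (v p.1 - v p.2) :=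
  Summable.of_norm_bounded ((summable_edge_sq hu).add (summable_edge_sq hv)) fun _ =>
    abs_weighted_mul_le (G.b_nonneg _ _) _ _

theorem summable_kill {u v : V → ℝ} (hu : G.Qmax u < ∞) (hv : G.Qmax v < ∞) :
    Summable fun x => G.c x * u x * v x :=
  Summable.of_norm_bounded ((summable_kill_sq hu).add (summable_kill_sq hv)) fun _ =>
    abs_weighted_mul_le (G.c_nonneg _) _ _

theorem Q_add_left {u u' v : V → ℝ} (hu : G.Qmax u < ∞) (hu' : G.Qmax u' < ∞)
    (hv : G.Qmax v < ∞) : G.Q (fun x => u x + u' x) v = G.Q u v + G.Q u' v := by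
  have h1 := (summable_edge hu hv).tsum_add (summable_edge hu' hv)
  have h2 := (summable_kill hu hv).tsum_add (summable_kill hu' hv)
  have e1 : ∑' p : V × V, G.b p.1 p.2 * ((u p.1 + u' p.1) - (u p.2 + u' p.2)) * (v p.1 - v p.2) =
      ∑' p : V × V, (G.b p.1 p.2 * (u p.1 - u p.2) * (v p.1 - v p.2) +
        G.b p.1 p.2 * (u' p.1 - u' p.2) * (v p.1 - v p.2)) := tsum_congr fun p => by ring
  have e2 : ∑' x, G.c x * (u x + u' x) * v x =
      ∑' x, (G.c x * u x * v x + G.c x * u' x * v x) := tsum_congr fun p => by ring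
  unfold Q
  rw [e1, e2, h1, h2]
  ring

theorem Q_smul_left (a : ℝ) (u v : V → ℝ) : G.Q (fun x => a * u x) v = a * G.Q u v := by
  have e1 : ∑' p : V × V, G.b p.1 p.2 * (a * u p.1 - a * u p.2) * (v p.1 - v p.2) =
      a * ∑' p : V × V, G.b p.1 p.2 * (u p.1 - u p.2) * (v p.1 - v p.2) := by
    rw [← tsum_mul_left]; exact tsum_congr fun p => by ring
  have e2 : ∑' x, G.c x * (a * u x) * v x = a * ∑' x, G.c x * u x * v x := by
    rw [← tsum_mul_left]; exact tsum_congr fun p => by ring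
  unfold Q
  rw [e1, e2]
  ring

variable (G)

/-! ### The operator -/

/-- The graph of the operator associated with the form: all pairs `(u, f)` with `u ∈ D(Q)` and
`Q(u, v) = ⟨f, v⟩` for all `v ∈ D(Q)`. -/
def operatorGraph : Submodule ℝ (G.L2 × G.L2) where
  carrier := {p | p.1 ∈ G.formDomain ∧ ∀ v ∈ G.formDomain, G.Q p.1 v = inner ℝ p.2 v}
  zero_mem' := by
    refine ⟨G.formDomain.zero_mem, fun v _ => ?_⟩
    simp [Q, L2.coe_zero]
  add_mem' := by
    rintro ⟨u, f⟩ ⟨u', f'⟩ ⟨hu, h⟩ ⟨hu', h'⟩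
    refine ⟨G.formDomain.add_mem hu hu', fun v hv => ?_⟩
    have := Q_add_left (G.Qmax_lt_top_of_mem hu) (G.Qmax_lt_top_of_mem hu')
      (G.Qmax_lt_top_of_mem hv)
    simp only [Prod.mk_add_mk, inner_add_left, L2.coe_add] at *
    rw [this, h v hv, h' v hv]
  smul_mem' := by
    rintro a ⟨u, f⟩ ⟨hu, h⟩
    refine ⟨G.formDomain.smul_mem a hu, fun v hv => ?_⟩
    simp only [Prod.smul_mk, inner_smul_left, L2.coe_smul, Q_smul_left] at *
    rw [h v hv]
    simp

/-- The operator `L` on `ℓ²(V, m)` associated with the form `Q`. -/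
def L : G.L2 →ₗ.[ℝ] G.L2 := G.operatorGraph.toLinearPMap

open Classical in
/-- The indicator function of a vertex, as an element of `ℓ²(V, m)`. -/
def indicator (x : V) : G.L2 :=
  ⟨Pi.single x 1, summable_of_ne_finset_zero (s := {x}) fun y hy => by
    simp [Pi.single_eq_of_ne (Finset.notMem_singleton.1 hy)]⟩

theorem operatorGraph_functional (p : G.L2 × G.L2) (hp : p ∈ G.operatorGraph) (h0 : p.1 = 0) :
    p.2 = 0 := by
  classical
  ext x
  have hx : G.indicator x ∈ G.formDomain := G.mem_formDomain_of_finite_support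
    ((Set.finite_singleton x).subset (by
      intro y hy
      by_contra hne
      exact hy (Pi.single_eq_of_ne hne _)))
  have h := hp.2 _ hx
  rw [h0, inner_def, tsum_eq_single x (fun y hy => by
    simp [indicator, Pi.single_eq_of_ne hy])] at h
  have hm := (G.m_pos x).ne'
  simp only [Q, L2.coe_zero, indicator, Pi.single_eq_same] at h
  simpa [hm, L2.coe_zero, eq_comm] using h

/-- `u ∈ D(L)` and `L u = f` if and only if `u ∈ D(Q)` and `Q(u, v) = ⟨f, v⟩` for all
`v ∈ D(Q)`. -/
theorem mem_graph_L {u f : G.L2} : (u, f) ∈ G.L.graph ↔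
    u ∈ G.formDomain ∧ ∀ v ∈ G.formDomain, G.Q u v = inner ℝ f v := by
  rw [L, Submodule.toLinearPMap_graph_eq _ G.operatorGraph_functional]
  rfl

end WeightedGraph

/-- The resolvent set of a (possibly unbounded) operator `A`: the real `r` for which
`A - r : D(A) → H` has a bounded everywhere defined inverse `R`. -/
def LinearPMap.realResolventSet {H : Type*} [NormedAddCommGroup H] [InnerProductSpace ℝ H]
    (A : H →ₗ.[ℝ] H) : Set ℝ :=
  {r | ∃ R : H →L[ℝ] H, (∀ f, ∃ h : R f ∈ A.domain, A ⟨R f, h⟩ - r • R f = f) ∧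
    ∀ u : A.domain, R (A u - r • (u : H)) = u}

/-- The spectrum: the complement of the resolvent set. For a self-adjoint operator the whole
spectrum is real and is obtained in this way. -/
def LinearPMap.realSpectrum {H : Type*} [NormedAddCommGroup H] [InnerProductSpace ℝ H]
    (A : H →ₗ.[ℝ] H) : Set ℝ :=
  A.realResolventSetᶜ

namespace WeightedGraph

variable {V : Type*} (G : WeightedGraph V)

/-- The ground state energy `E₀ = inf σ(L)`. -/
def groundStateEnergy : ℝ := sInf G.L.realSpectrum

/-! ### The formal operator, solutions and super-solutions -/

/-- The space `F̃` of functions on which the formal operator is defined. -/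
def Ftilde : Set (V → ℝ) := {w | ∀ x, Summable fun y => G.b x y * |w y|}

/-- The formal operator
`L̃ w(x) = (1 / m(x)) ∑_y b(x,y) (w(x) - w(y)) + (c(x) / m(x)) w(x)`. -/
def Ltilde (w : V → ℝ) (x : V) : ℝ :=
  1 / G.m x * ∑' y, G.b x y * (w x - w y) + G.c x / G.m x * w x

/-- `w ∈ F̃` satisfies `(L̃ - E) w ≥ 0`. -/
def IsSuperSolution (E : ℝ) (w : V → ℝ) : Prop :=
  w ∈ G.Ftilde ∧ ∀ x, 0 ≤ G.Ltilde w x - E * w x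

/-- `w ∈ F̃` satisfies `(L̃ - E) w = 0`. -/
def IsSolution (E : ℝ) (w : V → ℝ) : Prop :=
  w ∈ G.Ftilde ∧ ∀ x, G.Ltilde w x - E * w x = 0

end WeightedGraph

end

open scoped ENNReal

noncomputable section

namespace WeightedGraph

variable {V : Type*} {G : WeightedGraph V}

/-! ### The form norm as a Hilbert space norm -/

theorem norm_sq_eq_tsum (u : G.L2) : ‖u‖ ^ 2 = ∑' x, u x ^ 2 * G.m x := by
  rw [← real_inner_self_eq_norm_sq, inner_def]
  exact tsum_congr fun x => by ring

theorem enorm_sq_eq_tsum (u : G.L2) : ‖u‖ₑ ^ 2 = ∑' x, ENNReal.ofReal (u x ^ 2 * G.m x) := by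
  rw [← ofReal_norm, ← ENNReal.ofReal_pow (norm_nonneg _), norm_sq_eq_tsum,
    ENNReal.ofReal_tsum_of_nonneg (fun x => mul_nonneg (sq_nonneg _) (G.m_pos x).le) u.summable_sq]

theorem Q_comm (u v : V → ℝ) : G.Q u v = G.Q v u := by
  unfold Q
  congr 2
  · exact tsum_congr fun p => by ring
  · exact funext fun x => by ring

theorem Q_self_nonneg (u : V → ℝ) : 0 ≤ G.Q u u := by
  unfold Q
  refine add_nonneg (mul_nonneg (by norm_num) (tsum_nonneg fun p => ?_)) (tsum_nonneg fun x => ?_)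
  · rw [mul_assoc]
    exact mul_nonneg (G.b_nonneg _ _) (mul_self_nonneg _)
  · rw [mul_assoc]
    exact mul_nonneg (G.c_nonneg _) (mul_self_nonneg _)

theorem ofReal_Q_self {u : V → ℝ} (hu : G.Qmax u < ∞) : ENNReal.ofReal (G.Q u u) = G.Qmax u := by
  have hb : ∀ p : V × V, 0 ≤ G.b p.1 p.2 * (u p.1 - u p.2) ^ 2 := fun p =>
    mul_nonneg (G.b_nonneg _ _) (sq_nonneg _)
  have hc : ∀ x, 0 ≤ G.c x * u x ^ 2 := fun x => mul_nonneg (G.c_nonneg _) (sq_nonneg _)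
  have hQ : G.Q u u = 2⁻¹ * ∑' p : V × V, G.b p.1 p.2 * (u p.1 - u p.2) ^ 2
      + ∑' x, G.c x * u x ^ 2 := by
    unfold Q
    congr 2
    · exact tsum_congr fun p => by ring
    · exact funext fun x => by ring
  rw [hQ, ENNReal.ofReal_add (mul_nonneg (by norm_num) (tsum_nonneg hb)) (tsum_nonneg hc),
    ENNReal.ofReal_mul (by norm_num), ENNReal.ofReal_tsum_of_nonneg hb (summable_edge_sq hu),
    ENNReal.ofReal_tsum_of_nonneg hc (summable_kill_sq hu), Qmax,
    ENNReal.ofReal_inv_of_pos (by norm_num)]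
  simp

theorem formNormSq_eq_ofReal {u : G.L2} (hu : G.Qmax u < ∞) :
    G.formNormSq u = ENNReal.ofReal (‖u‖ ^ 2 + G.Q u u) := by
  rw [ENNReal.ofReal_add (sq_nonneg _) (Q_self_nonneg _), ofReal_Q_self hu, formNormSq,
    ← ofReal_norm, ENNReal.ofReal_pow (norm_nonneg _)]

variable (G) in
/-- The form domain, to be equipped with the scalar product `⟨u, v⟩ + Q(u, v)`. -/
def FormSpace : Type _ := G.formDomain

instance : AddCommGroup G.FormSpace := inferInstanceAs (AddCommGroup G.formDomain)

instance : Module ℝ G.FormSpace := inferInstanceAs (Module ℝ G.formDomain)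

variable (G) in
/-- The inclusion of the form domain into `ℓ²(V, m)`. -/
def FormSpace.incl : G.FormSpace →ₗ[ℝ] G.L2 := G.formDomain.subtype

theorem FormSpace.incl_mem (u : G.FormSpace) : FormSpace.incl G u ∈ G.formDomain := u.2

theorem FormSpace.incl_injective : Function.Injective (FormSpace.incl G) :=
  Subtype.val_injective

theorem FormSpace.Qmax_lt_top (u : G.FormSpace) : G.Qmax (FormSpace.incl G u) < ∞ :=
  G.Qmax_lt_top_of_mem u.incl_mem

variable (G) in
/-- The scalar product `⟨u, v⟩ + Q(u, v)` on the form domain. -/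
@[reducible] def formCore : InnerProductSpace.Core ℝ G.FormSpace where
  inner u v := inner ℝ (FormSpace.incl G u) (FormSpace.incl G v)
    + G.Q (FormSpace.incl G u) (FormSpace.incl G v)
  conj_inner_symm u v := by
    simp only [conj_trivial]
    rw [real_inner_comm, Q_comm]
  re_inner_nonneg u := by
    simp only [RCLike.re_to_real]
    exact add_nonneg real_inner_self_nonneg (Q_self_nonneg _)
  add_left u v w := by
    rw [map_add, inner_add_left, L2.coe_add,
      Q_add_left u.Qmax_lt_top v.Qmax_lt_top w.Qmax_lt_top]
    ring
  smul_left u v a := by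
    rw [map_smul, inner_smul_left, L2.coe_smul, Q_smul_left]
    simp only [conj_trivial]
    ring
  definite u h := by
    apply FormSpace.incl_injective
    rw [map_zero, ← inner_self_eq_zero (𝕜 := ℝ)]
    exact le_antisymm (by linarith [Q_self_nonneg (G := G) (FormSpace.incl G u)])
      real_inner_self_nonneg

instance : NormedAddCommGroup G.FormSpace := G.formCore.toNormedAddCommGroup

instance : InnerProductSpace ℝ G.FormSpace := InnerProductSpace.ofCore G.formCore.toCore

theorem FormSpace.inner_eq (u v : G.FormSpace) :
    inner ℝ u v = inner ℝ (FormSpace.incl G u) (FormSpace.incl G v)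
      + G.Q (FormSpace.incl G u) (FormSpace.incl G v) := rfl

theorem FormSpace.norm_sq_eq (u : G.FormSpace) :
    ‖u‖ ^ 2 = ‖FormSpace.incl G u‖ ^ 2 + G.Q (FormSpace.incl G u) (FormSpace.incl G u) := by
  rw [← real_inner_self_eq_norm_sq, FormSpace.inner_eq, real_inner_self_eq_norm_sq]

theorem FormSpace.norm_incl_le (u : G.FormSpace) : ‖FormSpace.incl G u‖ ≤ ‖u‖ := by
  refine le_of_sq_le_sq ?_ (norm_nonneg _)
  rw [u.norm_sq_eq]
  linarith [Q_self_nonneg (G := G) (FormSpace.incl G u)]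

theorem FormSpace.formNormSq_incl (u : G.FormSpace) :
    G.formNormSq (FormSpace.incl G u) = ENNReal.ofReal (‖u‖ ^ 2) := by
  rw [formNormSq_eq_ofReal u.Qmax_lt_top, u.norm_sq_eq]

variable (G) in
/-- The inclusion of the form domain into `ℓ²(V, m)` as a continuous map. -/
def FormSpace.inclL : G.FormSpace →L[ℝ] G.L2 :=
  (FormSpace.incl G).mkContinuous 1 fun u => by simpa using u.norm_incl_le

@[simp] theorem FormSpace.inclL_apply (u : G.FormSpace) :
    FormSpace.inclL G u = FormSpace.incl G u := rfl

theorem sq_mul_le_norm_sq (u : G.L2) (x : V) : u x ^ 2 * G.m x ≤ ‖u‖ ^ 2 := by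
  rw [norm_sq_eq_tsum]
  exact u.summable_sq.le_tsum x fun y _ => mul_nonneg (sq_nonneg _) (G.m_pos y).le

variable (G) in
/-- Evaluation at a vertex is continuous on `ℓ²(V, m)`. -/
def L2.eval (x : V) : G.L2 →L[ℝ] ℝ :=
  LinearMap.mkContinuous
    { toFun := fun u => u x
      map_add' := fun _ _ => rfl
      map_smul' := fun _ _ => rfl } (√(G.m x))⁻¹ fun u => by
    have hm := Real.sqrt_pos.2 (G.m_pos x)
    rw [← div_eq_inv_mul, le_div_iff₀ hm]
    refine le_of_sq_le_sq ?_ (norm_nonneg _)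
    rw [mul_pow, Real.sq_sqrt (G.m_pos x).le, Real.norm_eq_abs, sq_abs]
    exact sq_mul_le_norm_sq u x

@[simp] theorem L2.eval_apply (x : V) (u : G.L2) : L2.eval G x u = u x := rfl

variable (G) in
theorem lowerSemicontinuous_formNormSq :
    LowerSemicontinuous fun w : V → ℝ =>
      ∑' x, ENNReal.ofReal (w x ^ 2 * G.m x) + G.Qmax w := by
  have h1 : LowerSemicontinuous fun w : V → ℝ => ∑' x, ENNReal.ofReal (w x ^ 2 * G.m x) :=
    lowerSemicontinuous_tsum fun x =>
      Continuous.lowerSemicontinuous (ENNReal.continuous_ofReal.comp (by fun_prop))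
  have h2 : LowerSemicontinuous fun w : V → ℝ => ∑' x, ENNReal.ofReal (G.c x * w x ^ 2) :=
    lowerSemicontinuous_tsum fun x =>
      Continuous.lowerSemicontinuous (ENNReal.continuous_ofReal.comp (by fun_prop))
  have h3 : LowerSemicontinuous fun w : V → ℝ =>
      2⁻¹ * ∑' p : V × V, ENNReal.ofReal (G.b p.1 p.2 * (w p.1 - w p.2) ^ 2) := by
    simp_rw [← ENNReal.tsum_mul_left]
    exact lowerSemicontinuous_tsum fun p => Continuous.lowerSemicontinuous
      ((ENNReal.continuous_const_mul (by simp)).comp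
        (ENNReal.continuous_ofReal.comp (by fun_prop)))
  exact h1.add (h3.add h2)

instance : CompleteSpace G.FormSpace := by
  refine Metric.complete_of_cauchySeq_tendsto fun u hu => ?_
  have hx : ∀ x, ∃ a, Filter.Tendsto (fun n => FormSpace.incl G (u n) x) Filter.atTop (nhds a) :=
    fun x => cauchySeq_tendsto_of_complete
      (hu.map ((L2.eval G x).comp (FormSpace.inclL G)).uniformContinuous)
  choose w hw using hx
  have key : ∀ ε : ℝ, 0 < ε → ∃ N, ∀ k ≥ N,
      ∑' x, ENNReal.ofReal ((w x - FormSpace.incl G (u k) x) ^ 2 * G.m x)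
        + G.Qmax (fun x => w x - FormSpace.incl G (u k) x) ≤ ENNReal.ofReal (ε ^ 2) := by
    intro ε hε
    obtain ⟨N, hN⟩ := Metric.cauchySeq_iff.1 hu ε hε
    refine ⟨N, fun k hk => ?_⟩
    have hlim : Filter.Tendsto
        (fun n x => FormSpace.incl G (u n) x - FormSpace.incl G (u k) x) Filter.atTop
        (nhds fun x => w x - FormSpace.incl G (u k) x) :=
      tendsto_pi_nhds.2 fun x => (hw x).sub_const _
    refine (G.lowerSemicontinuous_formNormSq.isClosed_preimage
      (ENNReal.ofReal (ε ^ 2))).mem_of_tendsto hlim ?_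
    filter_upwards [Filter.eventually_ge_atTop N] with n hn
    have h := (u n - u k).formNormSq_incl
    rw [formNormSq, enorm_sq_eq_tsum, map_sub, L2.coe_sub] at h
    rw [Set.mem_preimage, Set.mem_Iic, h]
    have := hN n hn k hk
    rw [dist_eq_norm] at this
    exact ENNReal.ofReal_le_ofReal (pow_le_pow_left₀ (norm_nonneg _) this.le 2)
  have hsum : ∀ k, ∑' x, ENNReal.ofReal ((w x - FormSpace.incl G (u k) x) ^ 2 * G.m x) < ∞ →
      Summable fun x => (w x - FormSpace.incl G (u k) x) ^ 2 * G.m x := fun k hk =>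
    (ENNReal.summable_toReal hk.ne).congr fun x =>
      ENNReal.toReal_ofReal (mul_nonneg (sq_nonneg _) (G.m_pos x).le)
  obtain ⟨N, hN⟩ := key 1 one_pos
  have hd : (fun x => w x - FormSpace.incl G (u N) x) ∈ G.l2Submodule :=
    hsum N ((le_self_add.trans (hN N le_rfl)).trans_lt ENNReal.ofReal_lt_top)
  have hwmem : w ∈ G.l2Submodule := by
    have := G.l2Submodule.add_mem hd (FormSpace.incl G (u N)).2
    convert this using 1
    funext x
    simp
  let W : G.L2 := ⟨w, hwmem⟩
  have hWnorm : ∀ ε : ℝ, 0 < ε → ∃ N, ∀ k ≥ N,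
      G.formNormSq (W - FormSpace.incl G (u k)) ≤ ENNReal.ofReal (ε ^ 2) := by
    intro ε hε
    obtain ⟨N, hN⟩ := key ε hε
    refine ⟨N, fun k hk => ?_⟩
    rw [formNormSq, enorm_sq_eq_tsum, L2.coe_sub]
    exact hN k hk
  have hWmem : W ∈ G.formDomain := by
    intro ε hε
    obtain ⟨δ, hδ, hδε⟩ : ∃ δ : ℝ, 0 < δ ∧ ENNReal.ofReal (δ ^ 2) < ε / 4 := by
      obtain ⟨r, hr, hrε⟩ := ENNReal.lt_iff_exists_nnreal_btwn.1
        (ENNReal.div_pos hε.ne' (show (4 : ℝ≥0∞) ≠ ∞ by simp))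
      refine ⟨√r, Real.sqrt_pos.2 (by exact_mod_cast hr), ?_⟩
      rwa [Real.sq_sqrt r.coe_nonneg, ENNReal.ofReal_coe_nnreal]
    obtain ⟨N, hN⟩ := hWnorm δ hδ
    obtain ⟨φ, hφ, h⟩ := (u N).incl_mem (ε / 4) (ENNReal.div_pos hε.ne' (by simp))
    refine ⟨φ, hφ, ?_⟩
    have h1 := G.formNormSq_add_le (W - FormSpace.incl G (u N)) (FormSpace.incl G (u N) - φ)
    rw [sub_add_sub_cancel] at h1
    refine h1.trans_lt ?_
    have key : 2 * (G.formNormSq (W - FormSpace.incl G (u N))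
        + G.formNormSq (FormSpace.incl G (u N) - φ)) < 2 * (ε / 4 + ε / 4) :=
      ENNReal.mul_lt_mul_right (by simp) (by simp)
        (ENNReal.add_lt_add ((hN N le_rfl).trans_lt hδε) h)
    refine lt_of_lt_of_le (by rwa [← mul_add]) (le_of_eq ?_)
    rw [← two_mul, ← mul_assoc, show (2 : ℝ≥0∞) * 2 = 4 by norm_num]
    exact ENNReal.mul_div_cancel (by simp) (by simp)
  let W' : G.FormSpace := ⟨W, hWmem⟩
  refine ⟨W', Metric.tendsto_atTop.2 fun ε hε => ?_⟩
  obtain ⟨N, hN⟩ := hWnorm (ε / 2) (half_pos hε)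
  refine ⟨N, fun k hk => ?_⟩
  have h1 := (W' - u k).formNormSq_incl
  have h2 : FormSpace.incl G (W' - u k) = W - FormSpace.incl G (u k) := map_sub _ _ _
  rw [h2] at h1
  have h3 := hN k hk
  rw [h1, ENNReal.ofReal_le_ofReal_iff (sq_nonneg _)] at h3
  rw [dist_comm, dist_eq_norm]
  exact (le_of_sq_le_sq h3 (half_pos hε).le).trans_lt (half_lt_self hε)

theorem FormSpace.dense_finite_support :
    Dense {u : G.FormSpace | (Function.support (FormSpace.incl G u)).Finite} := by
  refine Metric.dense_iff.2 fun u ε hε => ?_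
  obtain ⟨φ, hφ, h⟩ := u.incl_mem (ENNReal.ofReal (ε ^ 2)) (ENNReal.ofReal_pos.2 (by positivity))
  let φ' : G.FormSpace := ⟨φ, G.mem_formDomain_of_finite_support hφ⟩
  refine ⟨φ', ?_, hφ⟩
  have h1 := (u - φ').formNormSq_incl
  have h2 : FormSpace.incl G (u - φ') = FormSpace.incl G u - φ := map_sub _ _ _
  rw [h2] at h1
  rw [h1, ENNReal.ofReal_lt_ofReal_iff (by positivity)] at h
  rw [Metric.mem_ball, dist_comm, dist_eq_norm]
  exact lt_of_pow_lt_pow_left₀ 2 hε.le h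

variable (G) in
/-- The form is bounded below by `E` on its domain. -/
def FormBound (E : ℝ) : Prop := ∀ u ∈ G.formDomain, E * ‖u‖ ^ 2 ≤ G.Q u u

theorem formBound_of_finite_support {E : ℝ}
    (h : ∀ φ : G.L2, (Function.support φ).Finite → E * ‖φ‖ ^ 2 ≤ G.Q φ φ) : G.FormBound E := by
  have hclosed : IsClosed {u : G.FormSpace | (E + 1) * ‖FormSpace.inclL G u‖ ^ 2 ≤ ‖u‖ ^ 2} :=
    isClosed_le (by fun_prop) (by fun_prop)
  have hall : ∀ u : G.FormSpace, (E + 1) * ‖FormSpace.inclL G u‖ ^ 2 ≤ ‖u‖ ^ 2 := by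
    intro u
    refine hclosed.closure_subset_iff.2 (fun φ hφ => ?_) (FormSpace.dense_finite_support u)
    have := h _ hφ
    rw [Set.mem_ofPred_eq, φ.norm_sq_eq, FormSpace.inclL_apply]
    linarith
  intro u hu
  let u' : G.FormSpace := ⟨u, hu⟩
  have := hall u'
  rw [FormSpace.norm_sq_eq, FormSpace.inclL_apply] at this
  change (E + 1) * ‖u‖ ^ 2 ≤ ‖u‖ ^ 2 + G.Q u u at this
  linarith

/-! ### The bottom of the spectrum -/

theorem FormBound.exists_mem_graph {E r : ℝ} (hE : G.FormBound E) (hr : r < E) (f : G.L2) :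
    ∃ u : G.L2, (u, f + r • u) ∈ G.L.graph := by
  let J := FormSpace.inclL G
  let B : G.FormSpace →L[ℝ] G.FormSpace →L[ℝ] ℝ :=
    innerSL ℝ - (1 + r) • (innerSL ℝ).bilinearComp J J
  have hB : ∀ u v : G.FormSpace, B u v = G.Q (FormSpace.incl G u) (FormSpace.incl G v)
      - r * inner ℝ (FormSpace.incl G u) (FormSpace.incl G v) := by
    intro u v
    have : B u v = inner ℝ u v - (1 + r) * inner ℝ (FormSpace.incl G u) (FormSpace.incl G v) := rfl
    rw [this, FormSpace.inner_eq]
    ring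
  have hcoer : IsCoercive B := by
    have hd : 0 < E - r := sub_pos.2 hr
    have hE' := abs_nonneg E
    have hpos : 0 < E - r + 1 + |E| := by linarith
    refine ⟨(E - r) / (E - r + 1 + |E|), div_pos hd hpos, fun u => ?_⟩
    have h1 := hE _ u.incl_mem
    have h2 := Q_self_nonneg (G := G) (FormSpace.incl G u)
    have h3 := le_abs_self E
    rw [hB, mul_assoc, ← pow_two, u.norm_sq_eq, real_inner_self_eq_norm_sq, div_mul_eq_mul_div,
      div_le_iff₀ hpos]
    have h4 := sq_nonneg ‖FormSpace.incl G u‖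
    set q := G.Q (FormSpace.incl G u) (FormSpace.incl G u)
    set n := ‖FormSpace.incl G u‖ ^ 2
    nlinarith [mul_nonneg (sub_nonneg.2 h1) (by linarith : 0 ≤ 1 + |E|),
      mul_nonneg (mul_nonneg hd.le h4) (sub_nonneg.2 h3),
      mul_nonneg (mul_nonneg hd.le hd.le) h4]
  let e := hcoer.continuousLinearEquivOfBilin
  let u := e.symm ((InnerProductSpace.toDual ℝ G.FormSpace).symm ((innerSL ℝ f).comp J))
  have hu : ∀ v, B u v = inner ℝ f (FormSpace.incl G v) := by
    intro v
    rw [← hcoer.continuousLinearEquivOfBilin_apply, e.apply_symm_apply,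
      InnerProductSpace.toDual_symm_apply]
    rfl
  refine ⟨FormSpace.incl G u, G.mem_graph_L.2 ⟨u.incl_mem, fun v hv => ?_⟩⟩
  let v' : G.FormSpace := ⟨v, hv⟩
  have h1 := hu v'
  have h2 : FormSpace.incl G v' = v := rfl
  rw [hB, h2] at h1
  rw [inner_add_left, real_inner_smul_left]
  linarith

theorem FormBound.norm_le_of_mem_graph {E r : ℝ} (hE : G.FormBound E) (hr : r < E) {u f : G.L2}
    (h : (u, f + r • u) ∈ G.L.graph) : ‖u‖ ≤ (E - r)⁻¹ * ‖f‖ := by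
  obtain ⟨hu, h⟩ := G.mem_graph_L.1 h
  have h1 := h u hu
  have h2 := hE u hu
  rw [inner_add_left, real_inner_smul_left, real_inner_self_eq_norm_sq] at h1
  have h3 := real_inner_le_norm f u
  have hd : 0 < E - r := sub_pos.2 hr
  rw [← div_eq_inv_mul, le_div_iff₀ hd]
  rcases (norm_nonneg u).eq_or_lt with h0 | h0
  · rw [← h0, zero_mul]
    exact norm_nonneg f
  · refine le_of_mul_le_mul_right ?_ h0
    linarith

theorem FormBound.mem_realResolventSet {E r : ℝ} (hE : G.FormBound E) (hr : r < E) :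
    r ∈ G.L.realResolventSet := by
  choose R hR using hE.exists_mem_graph hr
  have huniq : ∀ f u, (u, f + r • u) ∈ G.L.graph → u = R f := by
    intro f u hu
    have h := G.L.graph.sub_mem hu (hR f)
    have h' : (u - R f, (0 : G.L2) + r • (u - R f)) ∈ G.L.graph := by
      convert h using 1
      rw [Prod.mk_sub_mk]
      congr 1
      module
    have h2 := hE.norm_le_of_mem_graph hr h'
    rw [norm_zero, mul_zero] at h2
    exact sub_eq_zero.1 (norm_eq_zero.1 (le_antisymm h2 (norm_nonneg _)))
  let R' : G.L2 →ₗ[ℝ] G.L2 :=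
    { toFun := R
      map_add' := fun f g => by
        refine (huniq _ _ ?_).symm
        convert G.L.graph.add_mem (hR f) (hR g) using 1
        rw [Prod.mk_add_mk]
        congr 1
        module
      map_smul' := fun a f => by
        refine (huniq _ _ ?_).symm
        convert G.L.graph.smul_mem a (hR f) using 1
        rw [Prod.smul_mk]
        congr 1
        simp only [RingHom.id_apply]
        module }
  refine ⟨R'.mkContinuous (E - r)⁻¹ fun f => hE.norm_le_of_mem_graph hr (hR f),
    fun f => ?_, fun u => ?_⟩
  · obtain ⟨y, hy, hy'⟩ := (LinearPMap.mem_graph_iff _).1 (hR f)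
    have hy1 : (y : G.L2) = R f := hy
    have hy2 : G.L y = f + r • R f := hy'
    have hmem : R f ∈ G.L.domain := hy1 ▸ y.2
    refine ⟨hmem, ?_⟩
    have : y = ⟨R f, hmem⟩ := Subtype.ext hy1
    change G.L ⟨R f, hmem⟩ - r • R f = f
    rw [← this, hy2, add_sub_cancel_right]
  · refine (huniq _ _ ?_).symm
    rw [sub_add_cancel]
    exact G.L.mem_graph u

theorem FormBound.exists_gt {E : ℝ} (hE : G.FormBound E) (hres : E ∈ G.L.realResolventSet) :
    ∃ E' > E, G.FormBound E' := by
  obtain ⟨R, hR, -⟩ := hres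
  have hK : 0 < ‖R‖ + 1 := by positivity
  refine ⟨E + (‖R‖ + 1)⁻¹, by simpa using hK, fun v hv => ?_⟩
  obtain ⟨hdom, hRv⟩ := hR v
  have hgraph : (R v, v + E • R v) ∈ G.L.graph := by
    have := G.L.mem_graph ⟨R v, hdom⟩
    rwa [sub_eq_iff_eq_add.1 hRv] at this
  obtain ⟨hmem, hQ⟩ := G.mem_graph_L.1 hgraph
  have hRQ := hQ _ hmem
  have hvQ := hQ v hv
  rw [inner_add_left, real_inner_smul_left, real_inner_self_eq_norm_sq] at hRQ hvQ
  set t := -(‖R‖ + 1)⁻¹ with ht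
  have hsum := hE _ (G.formDomain.add_mem hv (G.formDomain.smul_mem t hmem))
  have hfv := G.Qmax_lt_top_of_mem hv
  have hfR := G.Qmax_lt_top_of_mem hmem
  have hft := G.Qmax_lt_top_of_mem (G.formDomain.smul_mem t hmem)
  have hfs := G.Qmax_lt_top_of_mem (G.formDomain.add_mem hv (G.formDomain.smul_mem t hmem))
  have hexp : G.Q (v + t • R v : G.L2) (v + t • R v : G.L2) =
      G.Q v v + 2 * t * G.Q (R v) v + t ^ 2 * G.Q (R v) (R v) := by
    rw [L2.coe_add, L2.coe_smul] at *
    rw [Q_add_left hfv hft hfs, Q_smul_left, Q_comm v, Q_comm (R v),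
      Q_add_left hfv hft hfv, Q_add_left hfv hft hfR, Q_smul_left, Q_smul_left, Q_comm v]
    have := Q_comm (G := G) v (R v)
    linear_combination t * this
  rw [hexp, norm_add_sq_real, norm_smul, mul_pow, Real.norm_eq_abs, sq_abs, real_inner_smul_right,
    hvQ, hRQ, real_inner_comm (R v) v] at hsum
  have hinner : inner ℝ v (R v) ≤ ‖R‖ * ‖v‖ ^ 2 := by
    calc inner ℝ v (R v) ≤ ‖v‖ * ‖R v‖ := real_inner_le_norm _ _
      _ ≤ ‖v‖ * (‖R‖ * ‖v‖) := by gcongr; exact R.le_opNorm v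
      _ = ‖R‖ * ‖v‖ ^ 2 := by ring
  have ht2 : t ^ 2 * inner ℝ v (R v) ≤ -t * ‖v‖ ^ 2 := by
    have h1 : t ^ 2 * (‖R‖ + 1) = -t := by
      rw [ht]
      field_simp
    calc t ^ 2 * inner ℝ v (R v) ≤ t ^ 2 * ((‖R‖ + 1) * ‖v‖ ^ 2) := by
          gcongr
          nlinarith [sq_nonneg ‖v‖]
      _ = -t * ‖v‖ ^ 2 := by rw [← mul_assoc, h1]
  have : (‖R‖ + 1)⁻¹ = -t := by rw [ht, neg_neg]
  rw [real_inner_comm] at ht2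
  rw [this]
  nlinarith

theorem FormBound.mono {E E' : ℝ} (hE : G.FormBound E) (h : E' ≤ E) : G.FormBound E' :=
  fun u hu => (mul_le_mul_of_nonneg_right h (sq_nonneg _)).trans (hE u hu)

variable (G) in
theorem formBound_zero : G.FormBound 0 := fun u _ => by
  rw [zero_mul]
  exact Q_self_nonneg _

theorem indicator_mem (x : V) : G.indicator x ∈ G.formDomain :=
  G.mem_formDomain_of_finite_support ((Set.finite_singleton x).subset (by
    classical
    intro y hy
    by_contra hne
    exact hy (Pi.single_eq_of_ne hne _)))

theorem norm_sq_indicator (x : V) : ‖G.indicator x‖ ^ 2 = G.m x := by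
  classical
  rw [norm_sq_eq_tsum, tsum_eq_single x fun y hy => by simp [indicator, Pi.single_eq_of_ne hy]]
  simp [indicator]

variable (G) in
theorem bddAbove_formBound [Nonempty V] : BddAbove {E | G.FormBound E} := by
  obtain ⟨x⟩ := ‹Nonempty V›
  refine ⟨G.Q (G.indicator x) (G.indicator x) / G.m x, fun E hE => ?_⟩
  rw [le_div_iff₀ (G.m_pos x), ← norm_sq_indicator]
  exact hE _ (indicator_mem x)

variable (G) in
theorem formBound_sSup [Nonempty V] : G.FormBound (sSup {E | G.FormBound E}) := by
  intro u hu
  have hne : {E | G.FormBound E}.Nonempty := ⟨0, G.formBound_zero⟩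
  rcases (sq_nonneg ‖u‖).eq_or_lt with h0 | h0
  · rw [← h0, mul_zero]
    exact Q_self_nonneg _
  · rw [← le_div_iff₀ h0]
    exact csSup_le hne fun E hE => (le_div_iff₀ h0).2 (hE u hu)

variable (G) in
theorem isLeast_realSpectrum [Nonempty V] :
    IsLeast G.L.realSpectrum (sSup {E | G.FormBound E}) := by
  refine ⟨fun hres => ?_, fun s hs => ?_⟩
  · obtain ⟨E, hE, hE'⟩ := G.formBound_sSup.exists_gt hres
    exact absurd (le_csSup G.bddAbove_formBound hE') (not_le.2 hE)
  · by_contra hlt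
    exact hs (G.formBound_sSup.mem_realResolventSet (not_le.1 hlt))

theorem le_groundStateEnergy_iff [Nonempty V] {E : ℝ} :
    E ≤ G.groundStateEnergy ↔ G.FormBound E := by
  rw [groundStateEnergy, G.isLeast_realSpectrum.csInf_eq]
  exact ⟨fun h => G.formBound_sSup.mono h, fun h => le_csSup G.bddAbove_formBound h⟩

/-! ### Green's formula and the ground state representation -/

theorem mem_Ftilde_of_finite_support {w : V → ℝ} (hw : (Function.support w).Finite) :
    w ∈ G.Ftilde := fun x =>
  summable_of_ne_finset_zero (s := hw.toFinset) fun y hy => by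
    have : w y = 0 := by simpa using hy
    simp [this]

theorem summable_b_mul {w : V → ℝ} (hw : w ∈ G.Ftilde) (x : V) :
    Summable fun y => G.b x y * w y :=
  Summable.of_norm ((hw x).congr fun y => by
    rw [Real.norm_eq_abs, abs_mul, abs_of_nonneg (G.b_nonneg _ _)])

theorem summable_b_mul_sub {w : V → ℝ} (hw : w ∈ G.Ftilde) (x : V) :
    Summable fun y => G.b x y * (w x - w y) :=
  (((G.b_summable x).mul_right (w x)).sub (summable_b_mul hw x)).congr fun y => by ring

variable (G) in
/-- The total edge weight at a vertex. -/
def deg (x : V) : ℝ := ∑' y, G.b x y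

theorem m_mul_Ltilde_sub {w : V → ℝ} (hw : w ∈ G.Ftilde) (E : ℝ) (x : V) :
    G.m x * (G.Ltilde w x - E * w x) =
      (G.deg x + G.c x - E * G.m x) * w x - ∑' y, G.b x y * w y := by
  have h : ∑' y, G.b x y * (w x - w y) = G.deg x * w x - ∑' y, G.b x y * w y := by
    rw [deg, ← tsum_mul_right, ← ((G.b_summable x).mul_right (w x)).tsum_sub (summable_b_mul hw x)]
    exact tsum_congr fun y => by ring
  have hm := (G.m_pos x).ne'
  rw [Ltilde, h]
  field_simp
  ring

theorem summable_row_mul {w ψ : V → ℝ} (hw : w ∈ G.Ftilde) (hψ : (Function.support ψ).Finite) :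
    Summable fun p : V × V => G.b p.1 p.2 * (w p.1 - w p.2) * ψ p.1 := by
  rw [← summable_abs_iff]
  refine (summable_prod_of_nonneg fun _ => abs_nonneg _).2
    ⟨fun x => ((summable_b_mul_sub hw x).mul_right (ψ x)).abs,
      summable_of_ne_finset_zero (s := hψ.toFinset) fun x hx => ?_⟩
  have : ψ x = 0 := by simpa using hx
  simp [this]

theorem edge_eq_row_add_row_swap (w ψ : V → ℝ) (p : V × V) :
    G.b p.1 p.2 * (w p.1 - w p.2) * (ψ p.1 - ψ p.2) =
      G.b p.1 p.2 * (w p.1 - w p.2) * ψ p.1 +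
        G.b p.swap.1 p.swap.2 * (w p.swap.1 - w p.swap.2) * ψ p.swap.1 := by
  rw [Prod.fst_swap, Prod.snd_swap, G.b_symm p.2 p.1]
  ring

theorem summable_edge_of_finite_support {w ψ : V → ℝ} (hw : w ∈ G.Ftilde)
    (hψ : (Function.support ψ).Finite) :
    Summable fun p : V × V => G.b p.1 p.2 * (w p.1 - w p.2) * (ψ p.1 - ψ p.2) :=
  ((summable_row_mul hw hψ).add (summable_row_mul hw hψ).prod_symm).congr fun p =>
    (edge_eq_row_add_row_swap w ψ p).symm

theorem summable_mul_of_finite_support {ψ : V → ℝ} (hψ : (Function.support ψ).Finite)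
    (f : V → ℝ) : Summable fun x => f x * ψ x :=
  summable_of_ne_finset_zero (s := hψ.toFinset) fun x hx => by
    have : ψ x = 0 := by simpa using hx
    simp [this]

/-- Green's formula. -/
theorem Q_eq_tsum_Ltilde {w ψ : V → ℝ} (hw : w ∈ G.Ftilde) (hψ : (Function.support ψ).Finite) :
    G.Q w ψ = ∑' x, G.m x * G.Ltilde w x * ψ x := by
  have hrow := summable_row_mul hw hψ
  have h1 : ∑' p : V × V, G.b p.1 p.2 * (w p.1 - w p.2) * (ψ p.1 - ψ p.2) =
      2 * ∑' x, (∑' y, G.b x y * (w x - w y)) * ψ x := by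
    have hswap := (Equiv.prodComm V V).tsum_eq
      fun p : V × V => G.b p.1 p.2 * (w p.1 - w p.2) * ψ p.1
    simp only [Equiv.prodComm_apply] at hswap
    rw [tsum_congr (edge_eq_row_add_row_swap w ψ), hrow.tsum_add hrow.prod_symm, hswap,
      ← two_mul, hrow.tsum_prod]
    simp_rw [tsum_mul_right]
  rw [Q, h1, inv_mul_cancel_left₀ two_ne_zero, ← Summable.tsum_add
    (summable_mul_of_finite_support hψ _) (summable_mul_of_finite_support hψ _)]
  refine tsum_congr fun x => ?_
  have hm := (G.m_pos x).ne'
  rw [Ltilde]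
  field_simp

theorem Q_sub_eq_tsum {w ψ : V → ℝ} (hw : w ∈ G.Ftilde) (hψ : (Function.support ψ).Finite)
    (E : ℝ) : G.Q w ψ - E * ∑' x, w x * G.m x * ψ x =
      ∑' x, G.m x * (G.Ltilde w x - E * w x) * ψ x := by
  rw [Q_eq_tsum_Ltilde hw hψ, ← tsum_mul_left, ← Summable.tsum_sub
    (summable_mul_of_finite_support hψ _)
    ((summable_mul_of_finite_support hψ fun x => w x * G.m x).mul_left E)]
  exact tsum_congr fun x => by ring

theorem exists_L2_of_finite_support {φ : V → ℝ} (hφ : (Function.support φ).Finite) :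
    ∃ u : G.L2, (u : V → ℝ) = φ :=
  ⟨⟨φ, (summable_mul_of_finite_support hφ fun x => φ x * G.m x).congr fun x => by ring⟩, rfl⟩

theorem sub_mul_div_sub_div_le_sq {s t α β : ℝ} (hα : 0 < α) (hβ : 0 < β) :
    (α - β) * (s ^ 2 / α - t ^ 2 / β) ≤ (s - t) * (s - t) := by
  have h : (s - t) * (s - t) - (α - β) * (s ^ 2 / α - t ^ 2 / β) =
      (β * s - α * t) ^ 2 / (α * β) := by
    field_simp
    ring
  have : 0 ≤ (β * s - α * t) ^ 2 / (α * β) := by positivity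
  linarith

theorem IsSuperSolution.formBound {E : ℝ} {w : V → ℝ} (hs : G.IsSuperSolution E w)
    (hw : ∀ x, 0 < w x) : G.FormBound E := by
  refine formBound_of_finite_support fun φ hφ => ?_
  set ψ : V → ℝ := fun x => φ x ^ 2 / w x with hψdef
  have hψ : (Function.support ψ).Finite := hφ.subset fun x hx h0 => hx (by simp [hψdef, h0])
  have hφtop := G.Qmax_lt_top_of_finite_support hφ
  have h1 : G.Q w ψ ≤ G.Q φ φ := by
    unfold Q
    refine add_le_add (mul_le_mul_of_nonneg_left ((summable_edge_of_finite_support hs.1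
      hψ).tsum_le_tsum (fun p => ?_) (summable_edge hφtop hφtop)) (by norm_num)) (le_of_eq ?_)
    · rw [mul_assoc, mul_assoc]
      exact mul_le_mul_of_nonneg_left (sub_mul_div_sub_div_le_sq (hw _) (hw _)) (G.b_nonneg _ _)
    · refine tsum_congr fun x => ?_
      have := (hw x).ne'
      simp only [hψdef]
      field_simp
  have h2 : 0 ≤ G.Q w ψ - E * ∑' x, w x * G.m x * ψ x := by
    rw [Q_sub_eq_tsum hs.1 hψ]
    exact tsum_nonneg fun x => mul_nonneg (mul_nonneg (G.m_pos x).le (hs.2 x))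
      (div_nonneg (sq_nonneg _) (hw x).le)
  have h3 : ∑' x, w x * G.m x * ψ x = ‖φ‖ ^ 2 := by
    rw [norm_sq_eq_tsum]
    refine tsum_congr fun x => ?_
    have := (hw x).ne'
    simp only [hψdef]
    field_simp
  rw [h3] at h2
  linarith

theorem eq_zero_of_adj {E : ℝ} {w : V → ℝ} (hw : w ∈ G.Ftilde) (hnn : ∀ x, 0 ≤ w x) {x y : V}
    (hx : w x = 0) (hs : 0 ≤ G.m x * (G.Ltilde w x - E * w x)) (hxy : G.Adj x y) : w y = 0 := by
  rw [m_mul_Ltilde_sub hw, hx, mul_zero, zero_sub] at hs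
  have h := (summable_b_mul hw x).le_tsum y fun z _ => mul_nonneg (G.b_nonneg x z) (hnn z)
  have hxy' : 0 < G.b x y := hxy
  exact le_antisymm (nonpos_of_mul_nonpos_right (by linarith) hxy') (hnn y)

theorem IsSuperSolution.pos {E : ℝ} {w : V → ℝ} (hs : G.IsSuperSolution E w) (hG : G.Connected)
    (hnn : ∀ x, 0 ≤ w x) (hne : w ≠ 0) (x : V) : 0 < w x := by
  refine (hnn x).lt_of_ne fun h0 => hne (funext fun y => ?_)
  induction hG x y with
  | refl => exact h0.symm
  | @tail y z _ hyz ih =>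
    exact eq_zero_of_adj hs.1 hnn ih (mul_nonneg (G.m_pos y).le (hs.2 y)) hyz

/-! ### Dirichlet problems on finite sets -/

theorem FormBound.eq_zero_of_le {E E' : ℝ} (hE : G.FormBound E) (hlt : E' < E) {φ : V → ℝ}
    (hφ : (Function.support φ).Finite) (h : G.Q φ φ - E' * ∑' x, φ x * G.m x * φ x ≤ 0) :
    φ = 0 := by
  obtain ⟨u, rfl⟩ := exists_L2_of_finite_support (G := G) hφ
  have h1 := hE u (G.mem_formDomain_of_finite_support hφ)
  have h2 : ∑' x, u x * G.m x * u x = ‖u‖ ^ 2 := by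
    rw [norm_sq_eq_tsum]
    exact tsum_congr fun x => by ring
  rw [h2] at h
  have h3 : ‖u‖ ^ 2 ≤ 0 := by
    by_contra hpos
    nlinarith [mul_pos (sub_pos.2 hlt) (not_le.1 hpos)]
  have h4 : u = 0 := norm_eq_zero.1 (pow_eq_zero_iff two_ne_zero |>.1
    (le_antisymm h3 (sq_nonneg _)))
  rw [h4]
  rfl

theorem finite_support_of_eq_zero {u : V → ℝ} {X : Finset V} (h : ∀ x ∉ X, u x = 0) :
    (Function.support u).Finite :=
  X.finite_toSet.subset fun x hx => by
    by_contra hX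
    exact hx (h x hX)

theorem FormBound.exists_dirichlet_solution {E E' : ℝ} (hE : G.FormBound E) (hlt : E' < E)
    (X : Finset V) (f : V → ℝ) :
    ∃ u : V → ℝ, (∀ x ∉ X, u x = 0) ∧ ∀ x ∈ X, G.m x * (G.Ltilde u x - E' * u x) = f x := by
  classical
  let T : (X → ℝ) →ₗ[ℝ] (X → ℝ) :=
    { toFun := fun v x => (G.deg x + G.c x - E' * G.m x) * v x - ∑ y : X, G.b x y * v y
      map_add' := fun v w => by
        funext x
        simp only [Pi.add_apply, mul_add, Finset.sum_add_distrib]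
        ring
      map_smul' := fun a v => by
        funext x
        simp only [Pi.smul_apply, smul_eq_mul, RingHom.id_apply, mul_sub, Finset.mul_sum]
        congr 1
        · ring
        · exact Finset.sum_congr rfl fun y _ => by ring }
  let ext : (X → ℝ) → V → ℝ := fun v x => if h : x ∈ X then v ⟨x, h⟩ else 0
  have hext0 : ∀ v, ∀ x ∉ X, ext v x = 0 := fun v x hx => dif_neg hx
  have hext : ∀ v (x : X), ext v x = v x := fun v x => dif_pos x.2
  have hT : ∀ v (x : X), G.m x * (G.Ltilde (ext v) x - E' * ext v x) = T v x := by
    intro v x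
    rw [m_mul_Ltilde_sub (mem_Ftilde_of_finite_support (finite_support_of_eq_zero (hext0 v))),
      hext, tsum_eq_sum (s := X) fun y hy => by rw [hext0 v y hy, mul_zero],
      ← Finset.sum_coe_sort X]
    simp_rw [hext]
    rfl
  have hinj : Function.Injective T := by
    refine (injective_iff_map_eq_zero T).2 fun v hv => ?_
    have hfin := finite_support_of_eq_zero (hext0 v)
    have h0 : ext v = 0 := by
      refine hE.eq_zero_of_le hlt hfin (le_of_eq ?_)
      rw [Q_sub_eq_tsum (mem_Ftilde_of_finite_support hfin) hfin]
      refine (tsum_congr fun x => ?_).trans tsum_zero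
      by_cases hx : x ∈ X
      · rw [hT v ⟨x, hx⟩, hv, Pi.zero_apply, zero_mul]
      · rw [hext0 v x hx, mul_zero]
    funext x
    rw [← hext v x, h0]
    rfl
  obtain ⟨v, hv⟩ := LinearMap.injective_iff_surjective.1 hinj fun x => f x
  exact ⟨ext v, hext0 v, fun x hx => by rw [hT v ⟨x, hx⟩, hv]⟩

theorem _root_.Real.posPart_mul_negPart (a : ℝ) : a⁺ * a⁻ = 0 := by
  rcases le_total 0 a with h | h
  · rw [negPart_eq_zero.2 h, mul_zero]
  · rw [posPart_eq_zero.2 h, zero_mul]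

theorem Q_negPart_le {u : V → ℝ} (hu : (Function.support u).Finite) :
    G.Q u u⁻ ≤ -G.Q u⁻ u⁻ := by
  have hn : (Function.support u⁻).Finite := hu.subset fun x hx h0 => hx (by simp [h0])
  have hut := G.Qmax_lt_top_of_finite_support hu
  have hnt := G.Qmax_lt_top_of_finite_support hn
  have key : ∀ s t : ℝ, (s - t) * (s⁻ - t⁻) ≤ -((s⁻ - t⁻) * (s⁻ - t⁻)) := by
    intro s t
    have h1 := posPart_sub_negPart s
    have h2 := posPart_sub_negPart t
    have h3 := s.posPart_mul_negPart
    have h4 := t.posPart_mul_negPart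
    have h5 := mul_nonneg (posPart_nonneg s) (negPart_nonneg t)
    have h6 := mul_nonneg (posPart_nonneg t) (negPart_nonneg s)
    have h7 : s - t = (s⁺ - s⁻) - (t⁺ - t⁻) := by rw [h1, h2]
    rw [h7]
    linarith
  unfold Q
  rw [neg_add, ← mul_neg, ← tsum_neg, ← tsum_neg]
  refine add_le_add (mul_le_mul_of_nonneg_left ((summable_edge hut hnt).tsum_le_tsum (fun p => ?_)
    (summable_edge hnt hnt).neg) (by norm_num))
    ((summable_kill hut hnt).tsum_le_tsum (fun x => ?_) (summable_kill hnt hnt).neg)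
  · rw [mul_assoc, mul_assoc, ← mul_neg]
    exact mul_le_mul_of_nonneg_left (key _ _) (G.b_nonneg _ _)
  · rw [mul_assoc, mul_assoc, ← mul_neg]
    refine mul_le_mul_of_nonneg_left ?_ (G.c_nonneg _)
    simpa using key (u x) 0

theorem FormBound.nonneg_of_dirichlet {E E' : ℝ} (hE : G.FormBound E) (hlt : E' < E)
    {X : Finset V} {u : V → ℝ} (hu : ∀ x ∉ X, u x = 0)
    (hs : ∀ x ∈ X, 0 ≤ G.m x * (G.Ltilde u x - E' * u x)) (x : V) : 0 ≤ u x := by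
  have hfin := finite_support_of_eq_zero hu
  have hn : (Function.support u⁻).Finite := hfin.subset fun x hx h0 => hx (by simp [h0])
  have h1 := Q_sub_eq_tsum (mem_Ftilde_of_finite_support (G := G) hfin) hn E'
  have h2 : 0 ≤ ∑' x, G.m x * (G.Ltilde u x - E' * u x) * u⁻ x := tsum_nonneg fun x => by
    by_cases hx : x ∈ X
    · exact mul_nonneg (hs x hx) (negPart_nonneg _)
    · simp [hu x hx]
  have h3 : ∑' x, u x * G.m x * u⁻ x = -∑' x, u⁻ x * G.m x * u⁻ x := by
    rw [← tsum_neg]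
    refine tsum_congr fun x => ?_
    have e1 := posPart_sub_negPart (u x)
    have e2 := (u x).posPart_mul_negPart
    rw [Pi.negPart_apply]
    linear_combination (-G.m x * (u x)⁻) * e1 + G.m x * e2
  have h4 : u⁻ = 0 := hE.eq_zero_of_le hlt hn (by
    have := Q_negPart_le (G := G) hfin
    rw [h3] at h1
    linarith)
  exact negPart_eq_zero.1 (congrFun h4 x)

variable (G) in
/-- The finite set `X` is connected within itself, as seen from `x₀`. -/
def ConnectedFrom (x₀ : V) (X : Finset V) : Prop :=
  ∀ y ∈ X, Relation.ReflTransGen (fun a b => a ∈ X ∧ G.Adj a b) x₀ y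

theorem ConnectedFrom.union [DecidableEq V] {x₀ : V} {X Y : Finset V} (hX : G.ConnectedFrom x₀ X)
    (hY : G.ConnectedFrom x₀ Y) : G.ConnectedFrom x₀ (X ∪ Y) := by
  intro y hy
  rcases Finset.mem_union.1 hy with h | h
  · exact Relation.ReflTransGen.mono
      (fun a b hab => ⟨Finset.mem_union_left _ hab.1, hab.2⟩) _ _ (hX y h)
  · exact Relation.ReflTransGen.mono
      (fun a b hab => ⟨Finset.mem_union_right _ hab.1, hab.2⟩) _ _ (hY y h)

theorem exists_connectedFrom_mem (hG : G.Connected) (x₀ y : V) :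
    ∃ X : Finset V, y ∈ X ∧ G.ConnectedFrom x₀ X := by
  classical
  induction hG x₀ y with
  | refl =>
    refine ⟨{x₀}, by simp, fun y hy => ?_⟩
    rw [Finset.mem_singleton.1 hy]
  | @tail y z _ hyz ih =>
    obtain ⟨X, hy, hX⟩ := ih
    have hX' : ∀ a ∈ X, Relation.ReflTransGen (fun a b => a ∈ insert z X ∧ G.Adj a b) x₀ a :=
      fun a ha => Relation.ReflTransGen.mono
        (fun a b hab => ⟨Finset.mem_insert_of_mem hab.1, hab.2⟩) _ _ (hX a ha)
    refine ⟨insert z X, Finset.mem_insert_self _ _, fun a ha => ?_⟩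
    rcases Finset.mem_insert.1 ha with rfl | ha
    · exact (hX' y hy).tail ⟨Finset.mem_insert_of_mem hy, hyz⟩
    · exact hX' a ha

theorem exists_connectedFrom_superset (hG : G.Connected) (x₀ : V) (F : Finset V) :
    ∃ X : Finset V, F ⊆ X ∧ G.ConnectedFrom x₀ X := by
  classical
  induction F using Finset.induction_on with
  | empty => exact ⟨∅, by simp, fun y hy => absurd hy (by simp)⟩
  | insert y F _ ih =>
    obtain ⟨X, hF, hX⟩ := ih
    obtain ⟨Y, hy, hY⟩ := exists_connectedFrom_mem hG x₀ y
    refine ⟨Y ∪ X, Finset.insert_subset (Finset.mem_union_left _ hy)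
      (hF.trans Finset.subset_union_right), hY.union hX⟩

/-- For `E' < E` there are normalised non-negative functions that solve `(L̃ - E') w = 0` on a
given finite set. -/
theorem FormBound.exists_solution_on_finset [Infinite V] {E E' : ℝ} (hE : G.FormBound E)
    (hlt : E' < E) (hG : G.Connected) (x₀ : V) (F : Finset V) :
    ∃ w : V → ℝ, w ∈ G.Ftilde ∧ (∀ x, 0 ≤ w x) ∧ w x₀ = 1 ∧
      ∀ x ∈ F, ∑' y, G.b x y * w y = (G.deg x + G.c x - E' * G.m x) * w x := by
  classical
  obtain ⟨z, hz⟩ := Infinite.exists_notMem_finset F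
  obtain ⟨X, hFX, hX⟩ := exists_connectedFrom_superset hG x₀ (insert z F)
  obtain ⟨u, hu0, hu⟩ := hE.exists_dirichlet_solution hlt X (Pi.single z 1)
  have huF : u ∈ G.Ftilde := mem_Ftilde_of_finite_support (finite_support_of_eq_zero hu0)
  have hs : ∀ x ∈ X, 0 ≤ G.m x * (G.Ltilde u x - E' * u x) := fun x hx => by
    rw [hu x hx]
    exact (Pi.single_nonneg (α := fun _ => ℝ)).2 zero_le_one x
  have hnn := hE.nonneg_of_dirichlet hlt hu0 hs
  have hzX : z ∈ X := hFX (Finset.mem_insert_self _ _)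
  have hpos : u x₀ ≠ 0 := by
    intro h0
    have hpath : ∀ y, Relation.ReflTransGen (fun a b => a ∈ X ∧ G.Adj a b) x₀ y → u y = 0 := by
      intro y hy
      induction hy with
      | refl => exact h0
      | tail _ hab ih => exact eq_zero_of_adj huF hnn ih (hs _ hab.1) hab.2
    have h1 := hu z hzX
    rw [m_mul_Ltilde_sub huF, hpath z (hX z hzX), mul_zero, Pi.single_eq_same] at h1
    have h2 : 0 ≤ ∑' y, G.b z y * u y := tsum_nonneg fun y => mul_nonneg (G.b_nonneg z y) (hnn y)
    linarith
  refine ⟨fun x => (u x₀)⁻¹ * u x, mem_Ftilde_of_finite_support (finite_support_of_eq_zero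
    (X := X) fun x hx => by rw [hu0 x hx, mul_zero]), fun x => mul_nonneg (inv_nonneg.2 (hnn _))
    (hnn x), inv_mul_cancel₀ hpos, fun x hx => ?_⟩
  have h1 := hu x (hFX (Finset.mem_insert_of_mem hx))
  rw [m_mul_Ltilde_sub huF, Pi.single_eq_of_ne (ne_of_mem_of_not_mem hx hz)] at h1
  simp_rw [mul_left_comm _ (u x₀)⁻¹]
  rw [tsum_mul_left]
  congr 1
  linarith

/-! ### Limits of solutions on finite sets -/

open Filter Topology in
theorem FormBound.exists_pos_superSolution [Infinite V] {E : ℝ} (hE : G.FormBound E)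
    (hG : G.Connected) : ∃ w : V → ℝ, (∀ x, 0 < w x) ∧ G.IsSuperSolution E w ∧
      (G.LocallyFinite → G.IsSolution E w) := by
  classical
  obtain ⟨x₀⟩ : Nonempty V := inferInstance
  have hex : ∀ p : Finset V × ℝ, ∃ w : V → ℝ, 0 < p.2 → w ∈ G.Ftilde ∧ (∀ x, 0 ≤ w x) ∧
      w x₀ = 1 ∧ ∀ x ∈ p.1, ∑' y, G.b x y * w y =
        (G.deg x + G.c x - (E - p.2) * G.m x) * w x := by
    intro p
    by_cases hp : 0 < p.2
    · obtain ⟨w, hw⟩ := hE.exists_solution_on_finset (sub_lt_self E hp) hG x₀ p.1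
      exact ⟨w, fun _ => hw⟩
    · exact ⟨0, fun h => absurd h hp⟩
  choose w hw using hex
  let l : Filter (Finset V × ℝ) := atTop ×ˢ 𝓝[>] 0
  let U : Ultrafilter (Finset V × ℝ) := Ultrafilter.of l
  have hU : (U : Filter _) ≤ l := Ultrafilter.of_le l
  have hU2 : Tendsto Prod.snd (U : Filter (Finset V × ℝ)) (𝓝[>] (0 : ℝ)) :=
    tendsto_snd.mono_left hU
  have hpos : ∀ᶠ p in (U : Filter (Finset V × ℝ)), 0 < p.2 := hU2 self_mem_nhdsWithin
  have hε : Tendsto Prod.snd (U : Filter (Finset V × ℝ)) (𝓝 (0 : ℝ)) :=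
    hU2.mono_right nhdsWithin_le_nhds
  have hmem : ∀ x, ∀ᶠ p in (U : Filter (Finset V × ℝ)), x ∈ p.1 := fun x =>
    ((tendsto_fst.mono_left hU).eventually (eventually_ge_atTop {x})).mono fun p hp =>
      Finset.singleton_subset_iff.1 hp
  have hfin : ∀ x (S : Finset V), ∀ᶠ p in (U : Filter (Finset V × ℝ)),
      ∑ y ∈ S, G.b x y * w p y ≤ (G.deg x + G.c x - (E - p.2) * G.m x) * w p x := by
    intro x S
    filter_upwards [hpos, hmem x] with p hp hx
    obtain ⟨h1, h2, -, h4⟩ := hw p hp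
    rw [← h4 x hx]
    exact (summable_b_mul h1 x).sum_le_tsum S fun y _ => mul_nonneg (G.b_nonneg x y) (h2 y)
  have hbdd : ∀ x, ∃ C, ∀ᶠ p in (U : Filter (Finset V × ℝ)), w p x ≤ C := by
    intro x
    induction hG x₀ x with
    | refl => exact ⟨1, hpos.mono fun p hp => (hw p hp).2.2.1.le⟩
    | @tail x y _ hxy ih =>
      obtain ⟨C, hC⟩ := ih
      have hb : 0 < G.b x y := hxy
      refine ⟨(|G.deg x + G.c x - E * G.m x| + G.m x) * C / G.b x y, ?_⟩
      filter_upwards [hC, hpos, hfin x {y}, hε.eventually (gt_mem_nhds one_pos)] with p h1 h2 h3 h4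
      rw [le_div_iff₀ hb, mul_comm]
      rw [Finset.sum_singleton] at h3
      have hnn := (hw p h2).2.1 x
      have hm := G.m_pos x
      refine h3.trans (mul_le_mul ?_ h1 hnn (by positivity))
      have := le_abs_self (G.deg x + G.c x - E * G.m x)
      nlinarith
  have hlim : ∀ x, ∃ a, Tendsto (fun p => w p x) U (𝓝 a) := by
    intro x
    obtain ⟨C, hC⟩ := hbdd x
    obtain ⟨a, -, ha⟩ := (isCompact_Icc (a := (0 : ℝ)) (b := C)).ultrafilter_le_nhds'
      (U.map fun p => w p x)
      (Filter.mem_map.2 ((hC.and hpos).mono fun p hp => ⟨(hw p hp.2).2.1 x, hp.1⟩))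
    exact ⟨a, ha⟩
  choose W hW using hlim
  have hWnn : ∀ x, 0 ≤ W x := fun x =>
    ge_of_tendsto (hW x) (hpos.mono fun p hp => (hw p hp).2.1 x)
  have hW0 : W x₀ = 1 := tendsto_nhds_unique (hW x₀)
    (tendsto_const_nhds.congr' (hpos.mono fun p hp => (hw p hp).2.2.1.symm))
  have hrhs : ∀ x, Tendsto (fun p => (G.deg x + G.c x - (E - p.2) * G.m x) * w p x) U
      (𝓝 ((G.deg x + G.c x - E * G.m x) * W x)) := by
    intro x
    have h := ((tendsto_const_nhds (x := G.deg x + G.c x)).sub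
      ((hε.const_sub E).mul_const (G.m x))).mul (hW x)
    rwa [sub_zero] at h
  have hlhs : ∀ x (S : Finset V), Tendsto (fun p => ∑ y ∈ S, G.b x y * w p y) U
      (𝓝 (∑ y ∈ S, G.b x y * W y)) := fun x S =>
    tendsto_finsetSum S fun y _ => (hW y).const_mul (G.b x y)
  have hle : ∀ x (S : Finset V), ∑ y ∈ S, G.b x y * W y ≤
      (G.deg x + G.c x - E * G.m x) * W x := fun x S =>
    le_of_tendsto_of_tendsto (hlhs x S) (hrhs x) (hfin x S)
  have hWF : W ∈ G.Ftilde := fun x => by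
    simp_rw [abs_of_nonneg (hWnn _)]
    exact summable_of_sum_le (fun y => mul_nonneg (G.b_nonneg x y) (hWnn y)) (hle x)
  have hsuper : G.IsSuperSolution E W := by
    refine ⟨hWF, fun x => nonneg_of_mul_nonneg_right ?_ (G.m_pos x)⟩
    rw [m_mul_Ltilde_sub hWF]
    exact sub_nonneg.2 (Real.tsum_le_of_sum_le
      (fun y => mul_nonneg (G.b_nonneg x y) (hWnn y)) (hle x))
  refine ⟨W, hsuper.pos hG hWnn fun h => ?_, hsuper, fun hlf => ⟨hWF, fun x => ?_⟩⟩
  · rw [h] at hW0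
    exact zero_ne_one hW0
  · have hsupp : ∀ v : V → ℝ, ∑' y, G.b x y * v y = ∑ y ∈ (hlf x).toFinset, G.b x y * v y :=
      fun v => tsum_eq_sum fun y hy => by
        have h0 : G.b x y = 0 := le_antisymm
          (not_lt.1 fun h => hy ((hlf x).mem_toFinset.2 h)) (G.b_nonneg x y)
        rw [h0, zero_mul]
    have heq : ∑' y, G.b x y * W y = (G.deg x + G.c x - E * G.m x) * W x := by
      rw [hsupp]
      refine tendsto_nhds_unique (hlhs x _) ((hrhs x).congr' ?_)
      filter_upwards [hpos, hmem x] with p hp hx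
      rw [← hsupp, (hw p hp).2.2.2 x hx]
    have h := m_mul_Ltilde_sub hWF E x
    rw [heq, sub_self] at h
    exact (mul_eq_zero.1 h).resolve_left (G.m_pos x).ne'

end WeightedGraph

end

theorem theorem3p1 {V : Type*} [Countable V] [Infinite V] (G : WeightedGraph V)
    (hG : G.Connected) (E : ℝ) :
    IsGLB G.L.realSpectrum G.groundStateEnergy ∧
    List.TFAE [
      E ≤ G.groundStateEnergy,
      ∃ w : V → ℝ, (∀ x, 0 ≤ w x) ∧ w ≠ 0 ∧ G.IsSuperSolution E w,
      ∃ w : V → ℝ, (∀ x, 0 < w x) ∧ G.IsSuperSolution E w] ∧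
    (G.LocallyFinite → List.TFAE [
      E ≤ G.groundStateEnergy,
      ∃ w : V → ℝ, (∀ x, 0 ≤ w x) ∧ w ≠ 0 ∧ G.IsSuperSolution E w,
      ∃ w : V → ℝ, (∀ x, 0 < w x) ∧ G.IsSuperSolution E w,
      ∃ w : V → ℝ, (∀ x, 0 < w x) ∧ G.IsSolution E w]) := by
  have hleast := G.isLeast_realSpectrum
  have h12 : E ≤ G.groundStateEnergy →
      ∃ w : V → ℝ, (∀ x, 0 ≤ w x) ∧ w ≠ 0 ∧ G.IsSuperSolution E w := fun h => by
    obtain ⟨w, hw, hs, -⟩ :=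
      (WeightedGraph.le_groundStateEnergy_iff.1 h).exists_pos_superSolution hG
    obtain ⟨x⟩ : Nonempty V := inferInstance
    exact ⟨w, fun x => (hw x).le, fun h0 => (hw x).ne' (congrFun h0 x), hs⟩
  have h23 : (∃ w : V → ℝ, (∀ x, 0 ≤ w x) ∧ w ≠ 0 ∧ G.IsSuperSolution E w) →
      ∃ w : V → ℝ, (∀ x, 0 < w x) ∧ G.IsSuperSolution E w := fun ⟨w, hnn, hne, hs⟩ =>
    ⟨w, hs.pos hG hnn hne, hs⟩
  have h31 : (∃ w : V → ℝ, (∀ x, 0 < w x) ∧ G.IsSuperSolution E w) → E ≤ G.groundStateEnergy :=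
    fun ⟨w, hw, hs⟩ => WeightedGraph.le_groundStateEnergy_iff.2 (hs.formBound hw)
  refine ⟨?_, ?_, fun hlf => ?_⟩
  · rw [WeightedGraph.groundStateEnergy, hleast.csInf_eq]
    exact hleast.isGLB
  · tfae_have 1 → 2 := h12
    tfae_have 2 → 3 := h23
    tfae_have 3 → 1 := h31
    tfae_finish
  · tfae_have 1 → 2 := h12
    tfae_have 2 → 3 := h23
    tfae_have 3 → 1 := h31
    tfae_have 1 → 4 := fun h => by
      obtain ⟨w, hw, -, hs⟩ :=
        (WeightedGraph.le_groundStateEnergy_iff.1 h).exists_pos_superSolution hG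
      exact ⟨w, hw, hs hlf⟩
    tfae_have 4 → 3 := fun ⟨w, hw, hs⟩ => ⟨w, hw, hs.1, fun x => (hs.2 x).ge⟩
    tfae_finish
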